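/- Let $\mathbb K$ be a field and let $\mathbb K\langle x,y\rangle$ be the free associative algebra in two variables. Let $\partial_x$ and $\partial_y$ be the linear maps of $\mathbb K\langle x,y\rangle$ given on monomials by $\partial_x w=u$ if $w=xu$ and $\partial_x w=0$ if $w$ does not begin with $x$, and likewise for $\partial_y$. A homogeneous potential of degree $d$ is an element $F\in\mathbb K\langle x,y\rangle$ that is homogeneous of degree $d$ (possibly zero) and cyclically invariant, that is, fixed by the linear map which moves the first letter of every monomial to its end. Its potential algebra is $A_F=\mathbb K\langle x,y\rangle/(\partial_xF,\partial_yF)$, graded by degree, with Hilbert series $H_{A_F}(t)=\sum_{k\ge 0}\dim_{\mathbb K}(A_F)_k\,t^k$. For a monomial $u$, let $u\circlearrowleft$ denote the sum of all distinct cyclic permutations of $u$. **Theorem.** 1. If $F$ is a homogeneous potential of degree $d\ge 4$, then $A_F$ is infinite dimensional over $\mathbb K$. 2. Let $n\ge 3$, and let $\mathcal P_n$ be the class of the algebras $A_F$ with $F$ a homogeneous potential of degree $n+1$. The coefficientwise minimal Hilbert series in $\mathcal P_n$ is $$H_n(t)=\frac{1}{1-2t+2t^n-t^{n+1}}.$$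 That is, for every homogeneous potential $F$ of degree $n+1$ and every $k\ge 0$, the coefficient of $t^k$ in $H_{A_F}$ is at least the coefficient of $t^k$ in the power series $H_n$. Moreover $x^{n-1}y^2\circlearrowleft$ is a homogeneous potential of degree $n+1$, and the Hilbert series of its potential algebra equals $H_n$. -/

import Mathlib

open scoped PowerSeries

noncomputable section

namespace PotentialAlgebra

/-- The free associative algebra `K⟨x, y⟩`; the generator `0` is `x` and the generator `1` is `y`. -/
abbrev FreeAlg (K : Type*) [Field K] : Type _ := FreeAlgebra K (Fin 2)

/-- The monomial of `K⟨x, y⟩` given by a word in the two letters. -/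
def word (K : Type*) [Field K] (l : List (Fin 2)) : FreeAlg K :=
  (l.map (FreeAlgebra.ι K)).prod

/-- The basis of `K⟨x, y⟩` indexed by words. Its members are the monomials, see `wordBasis_apply`. -/
def wordBasis (K : Type*) [Field K] : Module.Basis (List (Fin 2)) K (FreeAlg K) :=
  (FreeAlgebra.basisFreeMonoid K (Fin 2)).reindex FreeMonoid.toList

theorem wordBasis_apply (K : Type*) [Field K] (l : List (Fin 2)) :
    wordBasis K l = word K l := by
  simp only [wordBasis, word, Module.Basis.reindex_apply, FreeAlgebra.basisFreeMonoid]
  simp [FreeAlgebra.equivMonoidAlgebraFreeMonoid, FreeMonoid.lift_apply]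

/-- The partial derivative `∂/∂x` (for `i = 0`) or `∂/∂y` (for `i = 1`): the linear map that sends
a monomial `w` to `u` if `w = xᵢ u`, and to `0` if `w` does not begin with the letter `xᵢ`. -/
def pderiv (K : Type*) [Field K] (i : Fin 2) : FreeAlg K →ₗ[K] FreeAlg K :=
  (wordBasis K).constr K fun l =>
    match l with
    | [] => 0
    | a :: u => if a = i then word K u else 0

theorem pderiv_word_nil (K : Type*) [Field K] (i : Fin 2) : pderiv K i (word K []) = 0 := by
  rw [← wordBasis_apply, pderiv, Module.Basis.constr_basis]

theorem pderiv_word_cons (K : Type*) [Field K] (i a : Fin 2) (u : List (Fin 2)) :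
    pderiv K i (word K (a :: u)) = if a = i then word K u else 0 := by
  rw [← wordBasis_apply, pderiv, Module.Basis.constr_basis]

/-- The linear map that rotates every monomial by one letter, `xᵢ u ↦ u xᵢ`. -/
def rotate (K : Type*) [Field K] : FreeAlg K →ₗ[K] FreeAlg K :=
  (wordBasis K).constr K fun l => word K (l.rotate 1)

theorem rotate_word (K : Type*) [Field K] (l : List (Fin 2)) :
    rotate K (word K l) = word K (l.rotate 1) := by
  rw [← wordBasis_apply, rotate, Module.Basis.constr_basis]

/-- The space of homogeneous elements of degree `k` of `K⟨x, y⟩`. -/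
def homogeneous (K : Type*) [Field K] (k : ℕ) : Submodule K (FreeAlg K) :=
  Submodule.span K (word K '' {l | l.length = k})

/-- A homogeneous potential of degree `d`: a cyclically invariant element of `K⟨x, y⟩` that is
homogeneous of degree `d`. (For `d ≥ 3` its components of degree `0, 1, 2` vanish.) -/
structure IsHomogeneousPotential {K : Type*} [Field K] (d : ℕ) (F : FreeAlg K) : Prop where
  homogeneous : F ∈ homogeneous K d
  cyclic : rotate K F = F

/-- The two-sided ideal of `K⟨x, y⟩` generated by `∂F/∂x` and `∂F/∂y`. -/
def relIdeal {K : Type*} [Field K] (F : FreeAlg K) : TwoSidedIdeal (FreeAlg K) :=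
  TwoSidedIdeal.span {pderiv K 0 F, pderiv K 1 F}

/-- The potential algebra `A_F = K⟨x, y⟩ / (∂F/∂x, ∂F/∂y)`. -/
abbrev PotAlg {K : Type*} [Field K] (F : FreeAlg K) : Type _ :=
  (relIdeal F).ringCon.Quotient

/-- The quotient map `K⟨x, y⟩ → A_F` as a linear map. -/
def toPotAlg {K : Type*} [Field K] (F : FreeAlg K) : FreeAlg K →ₗ[K] PotAlg F :=
  ((relIdeal F).ringCon.mkₐ (α := K)).toLinearMap

/-- The degree `k` component of `A_F`: the image of the degree `k` component of `K⟨x, y⟩`. -/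
def component {K : Type*} [Field K] (F : FreeAlg K) (k : ℕ) : Submodule K (PotAlg F) :=
  (homogeneous K k).map (toPotAlg F)

/-- The components are finite dimensional, so that `Module.finrank` is their true dimension. -/
instance component_finite {K : Type*} [Field K] (F : FreeAlg K) (k : ℕ) :
    Module.Finite K (component F k) := by
  have h : Module.Finite K (homogeneous K k) :=
    Module.Finite.span_of_finite K ((List.finite_length_eq (Fin 2) k).image _)
  exact Module.Finite.map _ _

/-- The Hilbert series `∑ₖ dim (A_F)ₖ tᵏ` of the potential algebra of a homogeneous `F`. -/
def hilbertSeries {K : Type*} [Field K] (F : FreeAlg K) : ℚ⟦X⟧ :=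
  PowerSeries.mk fun k => (Module.finrank K (component F k) : ℚ)

/-- The power series `1 / (1 - 2t + 2tⁿ - tⁿ⁺¹)`. -/
def minimalSeries (n : ℕ) : ℚ⟦X⟧ :=
  (1 - 2 * PowerSeries.X + 2 * PowerSeries.X ^ n - PowerSeries.X ^ (n + 1))⁻¹

/-- `w ↻`: the sum of all (distinct) cyclic permutations of the monomial `w`. -/
def cyclicSum (K : Type*) [Field K] (w : List (Fin 2)) : FreeAlg K :=
  ∑ v ∈ w.cyclicPermutations.toFinset, word K v

/-- The word `xⁿ⁻¹y²` (used for `n ≥ 3`). -/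
def minimalWord (n : ℕ) : List (Fin 2) :=
  List.replicate (n - 1) 0 ++ [1, 1]

end PotentialAlgebra

end

/-!
# Minimal Hilbert series of potential algebras in two variables

Write `n = N + 3`, let `F` be a homogeneous potential of degree `n + 1`, and let
`r₀ = ∂F/∂x`, `r₁ = ∂F/∂y`. The degree `k` part of the relation ideal is spanned by the elements
`u rᵢ v` with `u`, `v` words and `|u| + n + |v| = k`; call `(u, i, v)` a triple. Whatever `F` is,
these spanning elements satisfy two families of linear relations (`syzygy`):

* the Koszul ones, obtained by expanding `u rᵢ m rⱼ v` either in `rᵢ` or in `rⱼ`;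
* the potential ones, `∑ᵢ u xᵢ rᵢ v = ∑ᵢ u rᵢ xᵢ v`, which hold because `∑ xᵢ rᵢ = F` and
  `∑ rᵢ xᵢ` is the rotation of `F`, hence also `F`.

So the ideal in degree `k` has dimension at most the number of triples minus the rank of the
syzygies of `F`. The syzygies and the spanning elements depend linearly (or constantly) on `F`, and
the rank of a linear family can only drop under specialization. Joining `F` and another potential
`G` by a line and passing to polynomials in the parameter gives the inequality
`dim I_k(F) + rank (syzygies of G) ≤ #triples`
(`finrank_relComponent_add_finrank_syzygyComponent_le`), in which a *different* potential `G` may be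
used to estimate the syzygies. This works over every field and needs no genericity.

For `G = xⁿ⁻¹y²↻` the relations have leading words `yyxⁿ⁻²` and `yxⁿ⁻¹`, with the single overlap
`yyxⁿ⁻¹`. Modulo the syzygies of `G` every triple reduces to triples `(u, i, v)` in which `v` avoids
the leading words and does not create the overlap (`single_mem_syzygyComponent_sup`). Such triples
correspond to the words of length `k` that contain a leading word (by locating its last occurrence),
so `dim I_k(F) ≤ 2ᵏ - #normal words` for every `F`. For `G` itself the usual rewriting shows that
the normal words span the quotient, so equality holds there. The normal words are counted by a
recursion equivalent to the power series `1 / (1 - 2t + 2tⁿ - tⁿ⁺¹)`. As `yᵏ` is always normal, no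
component of `A_F` vanishes, and `A_F` is infinite dimensional.
-/

noncomputable section

namespace PotentialAlgebra

/-! ### Semicontinuity of rank along a line -/

open Polynomial Module in
/-- Vectors of polynomials are linearly independent if they are so at a single point `c`: a
nontrivial relation could be divided by `X - c` indefinitely. -/
theorem linearIndependent_of_eval {K α κ : Type*} [Field K] (v : α → κ → K[X]) (c : K)
    (h : LinearIndependent K fun i k => (v i k).eval c) : LinearIndependent K[X] v := by
  rw [linearIndependent_iff''] at h ⊢
  have key : ∀ (m : ℕ) (s : Finset α) (g : α → K[X]), (∀ i ∉ s, g i = 0) →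
      ∑ i ∈ s, g i • v i = 0 → ∀ i, (X - C c) ^ m ∣ g i := by
    intro m
    induction m with
    | zero => intro s g _ _ i; simp
    | succ m ih =>
      intro s g hs hg i
      have h0 : ∀ i, (g i).eval c = 0 := by
        refine h s (fun i => (g i).eval c) (fun i hi => by simp [hs i hi]) ?_
        funext k
        have := congrArg (Polynomial.eval c) (congrFun hg k)
        simpa [Finset.sum_apply, Polynomial.eval_finsetSum] using this
      have h1 : ∀ i, ∃ q, g i = (X - C c) * q := fun i => dvd_iff_isRoot.mpr (h0 i)
      choose q hq using h1
      rw [hq i, pow_succ']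
      refine mul_dvd_mul_left _ (ih s q ?_ ?_ i)
      · intro i hi
        have := hs i hi
        rw [hq i] at this
        exact (mul_eq_zero.mp this).resolve_left (X_sub_C_ne_zero c)
      · have h2 : (X - C c) • ∑ i ∈ s, q i • v i = 0 := by
          rw [← hg, Finset.smul_sum]
          exact Finset.sum_congr rfl fun i _ => by rw [hq i, mul_smul]
        exact (smul_eq_zero.mp h2).resolve_left (X_sub_C_ne_zero c)
  intro s g hs hg i
  by_contra hne
  have h3 := natDegree_le_of_dvd (key ((g i).natDegree + 1) s g hs hg i) hne
  simp at h3

open Polynomial Module in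
/-- Let `M₀, M₁` be families of vectors and `N₀, N₁` families of coefficient vectors supported in
the finite set `I`, such that `N₀ + s (N₁ - N₀)` consists of relations of `M₀ + s (M₁ - M₀)` for all
`s`, as the three hypotheses say. Then the rank of `M₁` and the rank of `N₀` add up to at
most `|I|`, even though they belong to different values of `s`. -/
theorem finrank_span_add_finrank_span_le {K V ι ζ : Type*} [Field K] [AddCommGroup V] [Module K V]
    (I : Finset ι) (M₀ M₁ : ι → V) (N₀ N₁ : ζ → ι →₀ K)
    (hN₀ : ∀ z, N₀ z ∈ Finsupp.supported K K (I : Set ι))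
    (hN₁ : ∀ z, N₁ z ∈ Finsupp.supported K K (I : Set ι))
    (h₀₀ : ∀ z, Finsupp.linearCombination K M₀ (N₀ z) = 0)
    (h₁₁ : ∀ z, Finsupp.linearCombination K M₁ (N₁ z) = 0)
    (h₀₁ : ∀ z, Finsupp.linearCombination K M₀ (N₁ z) +
      Finsupp.linearCombination K M₁ (N₀ z) = 0) :
    finrank K (Submodule.span K (M₁ '' I)) + finrank K (Submodule.span K (Set.range N₀)) ≤
      I.card := by
  classical
  obtain ⟨α, a, ha, hspa, hlia⟩ := exists_linearIndependent' K (fun i : I => M₁ i)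
  obtain ⟨β, b, hb, hspb, hlib⟩ := exists_linearIndependent' K N₀
  let bV := Basis.ofVectorSpace K V
  -- `mcoef` and `ncoef` are the coordinates of `M₀ + X (M₁ - M₀)` and of `N₀ + X (N₁ - N₀)`; the
  -- images under `f` of the unit vectors `vl` are independent, whereas `vr` lies in its kernel
  let mcoef : I → Basis.ofVectorSpaceIndex K V → K[X] := fun t k =>
    C (bV.repr (M₀ t) k) * (1 - X) + C (bV.repr (M₁ t) k) * X
  let ncoef : ζ → I → K[X] := fun z t => C (N₀ z t) * (1 - X) + C (N₁ z t) * X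
  let f : (I → K[X]) →ₗ[K[X]] (Basis.ofVectorSpaceIndex K V → K[X]) :=
    Fintype.linearCombination K[X] mcoef
  let vl : α → I → K[X] := fun i => Pi.single (a i) 1
  let vr : β → I → K[X] := fun z => ncoef (b z)
  have hfl : LinearIndependent K[X] (f ∘ vl) := by
    -- at `s = 1` the images are the vectors `M₁`
    refine linearIndependent_of_eval _ 1 ?_
    have h1 : (fun i k => ((f ∘ vl) i k).eval 1) =
        (Finsupp.lcoeFun ∘ₗ bV.repr.toLinearMap) ∘ ((fun i : I => M₁ i) ∘ a) := by
      funext i k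
      simp [f, vl, mcoef, Fintype.linearCombination_apply_single]
    rw [h1]
    refine hlia.map' _ ?_
    rw [LinearMap.ker_eq_bot]
    exact (DFunLike.coe_injective).comp bV.repr.injective
  have hdis := Submodule.range_ker_disjoint hfl
  have hvl : LinearIndependent K[X] vl := LinearIndependent.of_comp f hfl
  have hvr : LinearIndependent K[X] vr := by
    -- at `s = 0` these vectors are the `N₀`
    refine linearIndependent_of_eval _ 0 ?_
    have h1 : (fun i k => (vr i k).eval 0) =
        (fun g : ι →₀ K => fun t : I => g t) ∘ (N₀ ∘ b) := by
      funext i k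
      simp [vr, ncoef]
    rw [h1]
    let r : (ι →₀ K) →ₗ[K] (I → K) := LinearMap.funLeft K K (Subtype.val) ∘ₗ Finsupp.lcoeFun
    have hdisj : Disjoint (Submodule.span K (Set.range (N₀ ∘ b))) (LinearMap.ker r) := by
      rw [Submodule.disjoint_def]
      intro x hx hxr
      have hx' : x ∈ Finsupp.supported K K (I : Set ι) :=
        Submodule.span_le.mpr (by rintro _ ⟨z, rfl⟩; exact hN₀ _) hx
      ext t
      by_cases ht : t ∈ I
      · exact congrFun (LinearMap.mem_ker.mp hxr) ⟨t, ht⟩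
      · exact (Finsupp.mem_supported' K x).mp hx' t (by simpa using ht)
    exact hlib.map hdisj
  have hsupp : ∀ (M : ι → V) (g : ι →₀ K), g ∈ Finsupp.supported K K (I : Set ι) → ∀ k,
      bV.repr (Finsupp.linearCombination K M g) k = ∑ t : I, g t * bV.repr (M t) k := by
    intro M g hg k
    rw [Finsupp.linearCombination_apply, Finsupp.sum_of_support_subset g
      (by exact_mod_cast (Finsupp.mem_supported K g).mp hg) _ (by simp), ← Finset.sum_coe_sort]
    simp [Finsupp.finsetSum_apply]
  have hker : ∀ z, f (ncoef z) = 0 := by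
    intro z
    funext k
    have e00 := hsupp M₀ _ (hN₀ z) k
    have e11 := hsupp M₁ _ (hN₁ z) k
    have e01 := hsupp M₀ _ (hN₁ z) k
    have e10 := hsupp M₁ _ (hN₀ z) k
    rw [h₀₀] at e00
    rw [h₁₁] at e11
    have e := congrArg (fun v => bV.repr v k) (h₀₁ z)
    simp only [map_add, Finsupp.add_apply, e01, e10, map_zero, Finsupp.zero_apply] at e e00 e11
    have e' : f (ncoef z) k = C (∑ t : I, N₀ z t * bV.repr (M₀ t) k) * (1 - X) ^ 2
        + C (∑ t : I, N₁ z t * bV.repr (M₁ t) k) * X ^ 2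
        + C (∑ t : I, N₁ z t * bV.repr (M₀ t) k + ∑ t : I, N₀ z t * bV.repr (M₁ t) k)
          * (X * (1 - X)) := by
      simp only [f, Fintype.linearCombination_apply, Finset.sum_apply, Pi.smul_apply, smul_eq_mul,
        ncoef, mcoef, map_add, map_sum, map_mul, Finset.sum_mul, ← Finset.sum_add_distrib]
      exact Finset.sum_congr rfl fun t _ => by ring
    rw [e', ← e00, ← e11, e]
    simp
  have hsum : LinearIndependent K[X] (Sum.elim vl vr) := by
    refine hvl.sum_type hvr (hdis.mono_right ?_)
    rw [Submodule.span_le]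
    rintro _ ⟨z, rfl⟩
    exact hker (b z)
  have hfin : Finite (α ⊕ β) := hsum.finite
  have : Fintype α := @Fintype.ofFinite _ (Finite.sum_left β)
  have : Fintype β := @Fintype.ofFinite _ (Finite.sum_right α)
  have hcard := hsum.fintype_card_le_finrank
  rw [Fintype.card_sum] at hcard
  have e1 : M₁ '' I = Set.range (fun i : I => M₁ i) := by
    ext; simp
  rw [e1, ← hspa, ← hspb, finrank_span_eq_card hlia, finrank_span_eq_card hlib]
  simpa using hcard

/-! ### Words: weight, normality and counting -/

/-- The number with binary digits given by the word, `x` being the digit `1` and `y` the digit `0`,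
least significant digit first. On words of equal length this is the lexicographic order read
from the right, with `x > y`. -/
def wordWeight : List (Fin 2) → ℕ
  | [] => 0
  | a :: l => (if a = 0 then 1 else 0) + 2 * wordWeight l

theorem wordWeight_append (u v : List (Fin 2)) :
    wordWeight (u ++ v) = wordWeight u + 2 ^ u.length * wordWeight v := by
  induction u with
  | nil => simp [wordWeight]
  | cons a u ih => simp only [List.cons_append, wordWeight, ih, List.length_cons]; ring

theorem wordWeight_replicate_zero (m : ℕ) :
    wordWeight (List.replicate m 0) + 1 = 2 ^ m := by
  induction m with
  | zero => simp [wordWeight]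
  | succ m ih => simp only [List.replicate_succ, wordWeight, pow_succ]; simp; omega

theorem wordWeight_injective {u v : List (Fin 2)} (hl : u.length = v.length)
    (hw : wordWeight u = wordWeight v) : u = v := by
  induction u generalizing v with
  | nil => exact (List.eq_nil_of_length_eq_zero hl.symm).symm
  | cons a u ih =>
    obtain _ | ⟨b, v⟩ := v
    · simp at hl
    · simp only [wordWeight] at hw
      simp only [List.length_cons, Nat.add_right_cancel_iff] at hl
      have h : a = b ∧ wordWeight u = wordWeight v := by
        fin_cases a <;> fin_cases b <;> simp at hw ⊢ <;> omega
      rw [h.1, ih hl h.2]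

/-- Among words of given length and given number of `y`s, the heaviest have all `y`s first; see
`wordWeight_leadingWord` for the case of equality. -/
theorem wordWeight_add_two_pow_count_le (u : List (Fin 2)) :
    wordWeight u + 2 ^ u.count 1 ≤ 2 ^ u.length := by
  induction u with
  | nil => simp [wordWeight]
  | cons a u ih =>
    have := Nat.one_le_two_pow (n := u.count 1)
    fin_cases a <;> simp [wordWeight, pow_succ] <;> omega

/-- The leading words `yyxⁿ⁻²` (for `i = 0`) and `yxⁿ⁻¹` (for `i = 1`) of the partial derivatives of
`xⁿ⁻¹y²↻`, where `n = N + 3`. -/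
def leadingWord (N : ℕ) (i : Fin 2) : List (Fin 2) :=
  if i = 0 then 1 :: 1 :: List.replicate (N + 1) 0 else 1 :: List.replicate (N + 2) 0

theorem length_leadingWord (N : ℕ) (i : Fin 2) : (leadingWord N i).length = N + 3 := by
  unfold leadingWord; split_ifs <;> simp

theorem leadingWord_injective (N : ℕ) : Function.Injective (leadingWord N) := by
  intro i j h
  fin_cases i <;> fin_cases j <;> simp [leadingWord, List.replicate_succ] at h ⊢

/-- A word is normal if it has no leading word as a factor. -/
def Normal (N : ℕ) : List (Fin 2) → Prop
  | [] => True
  | a :: w => Normal N w ∧ ∀ i, ¬ leadingWord N i <+: a :: w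

theorem exists_leadingWord_of_not_normal {N : ℕ} {w : List (Fin 2)} (h : ¬ Normal N w) :
    ∃ u i v, w = u ++ leadingWord N i ++ v := by
  induction w with
  | nil => exact absurd trivial h
  | cons a w ih =>
    by_cases hw : Normal N w
    · simp only [Normal, hw, true_and, not_forall, not_not] at h
      obtain ⟨i, v, hv⟩ := h
      exact ⟨[], i, v, by simpa using hv.symm⟩
    · obtain ⟨u, i, v, rfl⟩ := ih hw
      exact ⟨a :: u, i, v, by simp⟩

theorem normal_zero_cons {N : ℕ} {w : List (Fin 2)} : Normal N (0 :: w) ↔ Normal N w := by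
  simp only [Normal, and_iff_left_iff_imp]
  intro _ i
  fin_cases i <;> simp [leadingWord]

theorem normal_replicate_append {N m : ℕ} {w : List (Fin 2)} :
    Normal N (List.replicate m 0 ++ w) ↔ Normal N w := by
  induction m with
  | zero => simp
  | succ m ih => rw [List.replicate_succ, List.cons_append, normal_zero_cons, ih]

theorem normal_replicate_one (N m : ℕ) : Normal N (List.replicate m 1) := by
  induction m with
  | zero => trivial
  | succ m ih =>
    refine ⟨ih, fun i h => ?_⟩
    have h0 : (0 : Fin 2) ∈ leadingWord N i := by
      fin_cases i <;> simp [leadingWord]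
    have := h.subset h0
    rw [← List.replicate_succ] at this
    simpa using List.eq_of_mem_replicate this

/-- The condition on `v` for `leadingWord N i ++ v` to have its leading factor at the front as its
only one: `v` is normal, and for `i = 0` it does not begin with `x`, as `yyxⁿ⁻²x` ends in `yxⁿ⁻¹`. -/
def Reduced (N : ℕ) (i : Fin 2) (v : List (Fin 2)) : Prop :=
  Normal N v ∧ (i = 0 → ∀ w, v ≠ 0 :: w)

theorem normal_tail_leadingWord_append {N : ℕ} {i : Fin 2} {v : List (Fin 2)} :
    Normal N ((leadingWord N i).tail ++ v) ↔ Reduced N i v := by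
  have h0 : [0] <+: v ↔ ∃ w, v = 0 :: w := by
    constructor
    · rintro ⟨w, rfl⟩; exact ⟨w, rfl⟩
    · rintro ⟨w, rfl⟩; exact ⟨w, rfl⟩
  obtain rfl | rfl : i = 0 ∨ i = 1 := by omega
  · simp only [leadingWord, if_true, List.tail_cons, List.cons_append, Normal,
      normal_replicate_append, Reduced, Fin.forall_fin_two, true_implies]
    refine and_congr_right fun _ => ?_
    have e : List.replicate (N + 1 + 1) (0 : Fin 2) <+: List.replicate (N + 1) 0 ++ v ↔
        [0] <+: v := by
      rw [List.replicate_succ' (n := N + 1), List.prefix_append_right_inj]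
    have e' : ¬ 1 :: List.replicate (N + 1) (0 : Fin 2) <+: List.replicate (N + 1) 0 ++ v := by
      simp [List.replicate_succ]
    simp [e', e, h0]
  · simp [leadingWord, Reduced, normal_replicate_append]

/-- The normal words of length `k`. -/
def normalWords (N k : ℕ) : Set (List (Fin 2)) := {w | w.length = k ∧ Normal N w}

/-- The pairs `(i, v)` for which `leadingWord N i ++ v` is a word of length `k` whose tail is normal. -/
def overlapFreePairs (N k : ℕ) : Set (Fin 2 × List (Fin 2)) :=
  {p | N + 3 + p.2.length = k ∧ Reduced N p.1 p.2}

/-- The triples `(u, i, v)` of total degree `k` with `Reduced N i v`. They correspond to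
the words of length `k` that are not normal. -/
def reducedTriples (N k : ℕ) : Set (List (Fin 2) × Fin 2 × List (Fin 2)) :=
  {t | t.1.length + (N + 3) + t.2.2.length = k ∧ Reduced N t.2.1 t.2.2}

theorem finite_normalWords (N k : ℕ) : (normalWords N k).Finite :=
  (List.finite_length_eq (Fin 2) k).subset fun _ h => h.1

theorem finite_overlapFreePairs (N k : ℕ) : (overlapFreePairs N k).Finite :=
  (Set.finite_univ.prod (List.finite_length_le (Fin 2) k)).subset fun p h =>
    ⟨trivial, by have := h.1; simp; omega⟩

theorem finite_triples (k : ℕ) :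
    {t : List (Fin 2) × Fin 2 × List (Fin 2) | t.1.length ≤ k ∧ t.2.2.length ≤ k}.Finite :=
  ((List.finite_length_le (Fin 2) k).prod
    (Set.finite_univ.prod (List.finite_length_le (Fin 2) k))).subset fun _ h =>
      ⟨h.1, trivial, h.2⟩

theorem finite_reducedTriples (N k : ℕ) : (reducedTriples N k).Finite :=
  (finite_triples k).subset fun t h => by have := h.1; constructor <;> omega

/-- Put a letter in front of a normal word: the result is normal or begins with a leading word. -/
theorem ncard_normalWords_succ (N k : ℕ) :
    (normalWords N (k + 1)).ncard + (overlapFreePairs N (k + 1)).ncard =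
      2 * (normalWords N k).ncard := by
  have hinj : Function.Injective fun p : Fin 2 × List (Fin 2) => p.1 :: p.2 := by
    rintro ⟨a, u⟩ ⟨b, v⟩ h
    simpa using h
  have hinj' : Function.Injective
      fun p : Fin 2 × List (Fin 2) => leadingWord N p.1 ++ p.2 := by
    rintro ⟨a, u⟩ ⟨b, v⟩ h
    have := List.append_inj h (by simp [length_leadingWord])
    exact Prod.ext (leadingWord_injective N this.1) this.2
  have e : (fun p : Fin 2 × List (Fin 2) => p.1 :: p.2) '' (Set.univ ×ˢ normalWords N k) =
      normalWords N (k + 1) ∪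
        (fun p : Fin 2 × List (Fin 2) => leadingWord N p.1 ++ p.2) ''
          overlapFreePairs N (k + 1) := by
    ext w
    constructor
    · rintro ⟨⟨a, u⟩, ⟨-, hu, hn⟩, rfl⟩
      by_cases h : Normal N (a :: u)
      · exact Or.inl ⟨by simpa using hu, h⟩
      · refine Or.inr ?_
        simp only [Normal, show Normal N u from hn, true_and, not_forall, not_not] at h
        obtain ⟨i, v, hv⟩ := h
        refine ⟨(i, v), ⟨?_, ?_⟩, hv⟩
        · have := congrArg List.length hv
          simp only [List.length_append, length_leadingWord, List.length_cons] at this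
          simp at hu
          simp; omega
        · rw [← normal_tail_leadingWord_append]
          have h2 := congrArg List.tail hv
          rw [List.tail_append_of_ne_nil (by
            intro h; simpa [h] using length_leadingWord N i)] at h2
          rw [h2]; exact hn
    · rintro (⟨hl, hn⟩ | ⟨⟨i, v⟩, ⟨hl, hn⟩, rfl⟩)
      · obtain _ | ⟨a, u⟩ := w
        · simp at hl
        · exact ⟨(a, u), ⟨trivial, by simpa using hl, hn.1⟩, rfl⟩
      · have h1 : leadingWord N i = 1 :: (leadingWord N i).tail := by
          unfold leadingWord; split_ifs <;> rfl
        refine ⟨(1, (leadingWord N i).tail ++ v), ⟨trivial, ?_, ?_⟩, ?_⟩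
        · simp [length_leadingWord] at hl ⊢; omega
        · exact normal_tail_leadingWord_append.mpr hn
        · simp only; rw [← List.cons_append, ← h1]
  have hdis : Disjoint (normalWords N (k + 1))
      ((fun p : Fin 2 × List (Fin 2) => leadingWord N p.1 ++ p.2) ''
          overlapFreePairs N (k + 1)) := by
    rw [Set.disjoint_left]
    rintro _ ⟨hl, hn⟩ ⟨⟨i, v⟩, -, rfl⟩
    have h1 : leadingWord N i = 1 :: (leadingWord N i).tail := by
      unfold leadingWord; split_ifs <;> rfl
    simp only [] at hn
    rw [h1, List.cons_append] at hn
    refine hn.2 i ?_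
    rw [← List.cons_append, ← h1]
    exact List.prefix_append _ _
  rw [← Set.ncard_image_of_injective _ hinj', ← Set.ncard_union_eq hdis (finite_normalWords _ _)
    ((finite_overlapFreePairs _ _).image _), ← e, Set.ncard_image_of_injective _ hinj,
    Set.ncard_prod]
  simp

theorem ncard_reducedTriples_succ (N k : ℕ) :
    (reducedTriples N (k + 1)).ncard =
      2 * (reducedTriples N k).ncard + (overlapFreePairs N (k + 1)).ncard := by
  have hinj : Function.Injective
      fun p : Fin 2 × (List (Fin 2) × Fin 2 × List (Fin 2)) => (p.1 :: p.2.1, p.2.2) := by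
    rintro ⟨a, u, i, v⟩ ⟨b, u', j, v'⟩ h
    simpa [and_assoc] using h
  have hinj' : Function.Injective
      fun p : Fin 2 × List (Fin 2) => (([] : List (Fin 2)), p) := by
    intro p q h
    simpa using h
  have e : reducedTriples N (k + 1) =
      (fun p : Fin 2 × (List (Fin 2) × Fin 2 × List (Fin 2)) => (p.1 :: p.2.1, p.2.2)) ''
        (Set.univ ×ˢ reducedTriples N k) ∪
      (fun p : Fin 2 × List (Fin 2) => (([] : List (Fin 2)), p)) ''
        overlapFreePairs N (k + 1) := by
    ext ⟨u, i, v⟩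
    constructor
    · rintro ⟨hl, hr⟩
      obtain _ | ⟨a, u⟩ := u
      · exact Or.inr ⟨(i, v), ⟨by simpa using hl, hr⟩, rfl⟩
      · refine Or.inl ⟨(a, u, i, v), ⟨trivial, ?_, hr⟩, rfl⟩
        simp at hl ⊢; omega
    · rintro (⟨⟨a, u, i, v⟩, ⟨-, hl, hr⟩, h⟩ | ⟨⟨i, v⟩, ⟨hl, hr⟩, h⟩) <;>
        simp only [Prod.mk.injEq] at h <;> obtain ⟨rfl, rfl, rfl⟩ := h
      · exact ⟨by simp at hl ⊢; omega, hr⟩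
      · exact ⟨by simpa using hl, hr⟩
  have hdis : Disjoint
      ((fun p : Fin 2 × (List (Fin 2) × Fin 2 × List (Fin 2)) => (p.1 :: p.2.1, p.2.2)) ''
        (Set.univ ×ˢ reducedTriples N k))
      ((fun p : Fin 2 × List (Fin 2) => (([] : List (Fin 2)), p)) ''
        overlapFreePairs N (k + 1)) := by
    rw [Set.disjoint_left]
    rintro _ ⟨p, -, rfl⟩ ⟨q, -, h⟩
    simp at h
  rw [e, Set.ncard_union_eq hdis ((Set.finite_univ.prod (finite_reducedTriples _ _)).image _)
    ((finite_overlapFreePairs _ _).image _), Set.ncard_image_of_injective _ hinj,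
    Set.ncard_image_of_injective _ hinj', Set.ncard_prod]
  simp

theorem normalWords_zero (N : ℕ) : normalWords N 0 = {[]} := by
  ext w
  constructor
  · rintro ⟨h, -⟩; simpa using h
  · rintro rfl; exact ⟨rfl, trivial⟩

theorem ncard_normalWords_add_ncard_reducedTriples (N k : ℕ) :
    (normalWords N k).ncard + (reducedTriples N k).ncard = 2 ^ k := by
  induction k with
  | zero =>
    have : reducedTriples N 0 = ∅ := by
      ext t; simp [reducedTriples]
    simp [normalWords_zero, this]
  | succ k ih =>
    have h1 := ncard_normalWords_succ N k
    have h2 := ncard_reducedTriples_succ N k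
    rw [pow_succ]; omega

theorem overlapFreePairs_of_lt {N k : ℕ} (h : k < N + 3) : overlapFreePairs N k = ∅ := by
  ext p
  simp only [overlapFreePairs, Set.mem_ofPred_eq, Set.mem_empty_iff_false, iff_false]
  rintro ⟨h1, -⟩
  omega

theorem overlapFreePairs_self (N : ℕ) :
    (overlapFreePairs N (N + 3)).ncard = 2 := by
  have : overlapFreePairs N (N + 3) = Set.univ ×ˢ {[]} := by
    ext ⟨i, v⟩
    constructor
    · rintro ⟨h, -⟩
      exact ⟨trivial, by simpa using h⟩
    · rintro ⟨-, h⟩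
      obtain rfl : v = [] := h
      exact ⟨rfl, trivial, by simp⟩
  rw [this, Set.ncard_prod]
  simp

/-- The pairs `(i, v)` with `v` normal that are excluded from `overlapFreePairs` are those
with `i = 0` and `v = x w`, where `w` is an arbitrary normal word. -/
theorem ncard_overlapFreePairs_add (N j : ℕ) :
    (overlapFreePairs N (N + 3 + (j + 1))).ncard + (normalWords N j).ncard =
      2 * (normalWords N (j + 1)).ncard := by
  have hinj : Function.Injective fun v : List (Fin 2) => ((0 : Fin 2), 0 :: v) := by
    intro p q h
    simpa using h
  have e : Set.univ ×ˢ normalWords N (j + 1) = overlapFreePairs N (N + 3 + (j + 1)) ∪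
      (fun v : List (Fin 2) => ((0 : Fin 2), 0 :: v)) '' normalWords N j := by
    ext ⟨i, v⟩
    constructor
    · rintro ⟨-, hl, hn⟩
      by_cases h : i = 0 → ∀ w, v ≠ 0 :: w
      · exact Or.inl ⟨by simpa using hl, hn, h⟩
      · push Not at h
        obtain ⟨rfl, w, rfl⟩ := h
        exact Or.inr ⟨w, ⟨by simpa using hl, normal_zero_cons.mp hn⟩, rfl⟩
    · rintro (⟨hl, hr⟩ | ⟨w, ⟨hl, hn⟩, h⟩)
      · exact ⟨trivial, by simpa using hl, hr.1⟩
      · simp only [Prod.mk.injEq] at h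
        obtain ⟨rfl, rfl⟩ := h
        exact ⟨trivial, by simpa using hl, normal_zero_cons.mpr hn⟩
  have hdis : Disjoint (overlapFreePairs N (N + 3 + (j + 1)))
      ((fun v : List (Fin 2) => ((0 : Fin 2), 0 :: v)) '' normalWords N j) := by
    rw [Set.disjoint_left]
    rintro _ ⟨-, hr⟩ ⟨w, -, rfl⟩
    exact hr.2 rfl w rfl
  rw [← Set.ncard_image_of_injective _ hinj, ← Set.ncard_union_eq hdis
    (finite_overlapFreePairs _ _) ((finite_normalWords _ _).image _), ← e, Set.ncard_prod]
  simp

open PowerSeries in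
/-- The minimal series counts normal words. -/
theorem coeff_minimalSeries (N k : ℕ) :
    coeff k (minimalSeries (N + 3)) = ((normalWords N k).ncard : ℚ) := by
  have h : (PowerSeries.mk fun k => ((normalWords N k).ncard : ℚ)) *
      (1 - 2 * X + 2 * X ^ (N + 3) - X ^ (N + 3 + 1)) = 1 := by
    ext k
    have e : (PowerSeries.mk fun k => ((normalWords N k).ncard : ℚ)) *
      (1 - 2 * X + 2 * X ^ (N + 3) - X ^ (N + 3 + 1)) =
      (PowerSeries.mk fun k => ((normalWords N k).ncard : ℚ))
      - C 2 * (X ^ 1 * (PowerSeries.mk fun k => ((normalWords N k).ncard : ℚ)))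
      + C 2 * (X ^ (N + 3) * (PowerSeries.mk fun k => ((normalWords N k).ncard : ℚ)))
      - X ^ (N + 3 + 1) * (PowerSeries.mk fun k => ((normalWords N k).ncard : ℚ)) := by
      rw [show (C 2 : ℚ⟦X⟧) = 2 from map_ofNat _ 2]
      ring
    rw [e]
    simp only [map_add, map_sub, coeff_C_mul, coeff_X_pow_mul', coeff_mk, coeff_one]
    obtain _ | k := k
    · simp [normalWords_zero]
    · have h1 : ((normalWords N (k + 1)).ncard : ℚ) + (overlapFreePairs N (k + 1)).ncard =
        2 * (normalWords N k).ncard := by exact_mod_cast ncard_normalWords_succ N k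
      rw [if_pos (by omega : 1 ≤ k + 1), if_neg (by omega : ¬ k + 1 = 0), Nat.add_sub_cancel]
      rcases lt_trichotomy (k + 1) (N + 3) with hk | hk | hk
      · rw [overlapFreePairs_of_lt hk] at h1
        rw [if_neg (by omega), if_neg (by omega)]
        simp at h1
        linarith
      · rw [hk, overlapFreePairs_self] at h1
        rw [if_pos (by omega), if_neg (by omega), hk, Nat.sub_self, normalWords_zero]
        simp at h1 ⊢
        linarith
      · obtain ⟨j, rfl⟩ : ∃ j, k = N + 3 + j := ⟨k - (N + 3), by omega⟩
        have h2 : ((overlapFreePairs N (N + 3 + (j + 1))).ncard : ℚ) + (normalWords N j).ncard =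
          2 * (normalWords N (j + 1)).ncard := by exact_mod_cast ncard_overlapFreePairs_add N j
        rw [if_pos (by omega), if_pos (by omega),
          show N + 3 + j + 1 - (N + 3) = j + 1 by omega,
          show N + 3 + j + 1 - (N + 3 + 1) = j by omega]
        rw [← add_assoc] at h2
        linarith
  have h0 : constantCoeff (1 - 2 * X + 2 * X ^ (N + 3) - X ^ (N + 3 + 1) : ℚ⟦X⟧) ≠ 0 := by
    simp
  have : minimalSeries (N + 3) = PowerSeries.mk fun k => ((normalWords N k).ncard : ℚ) := by
    rw [minimalSeries, eq_comm, PowerSeries.eq_inv_iff_mul_eq_one h0]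
    exact h
  rw [this, coeff_mk]

variable {K : Type*} [Field K]

/-! ### The relation ideal and its homogeneous components -/

theorem word_append (u v : List (Fin 2)) : word K (u ++ v) = word K u * word K v := by
  simp [word]

theorem word_cons (a : Fin 2) (u : List (Fin 2)) : word K (a :: u) = word K [a] * word K u := by
  rw [← word_append]; rfl

theorem word_nil : word K [] = 1 := by simp [word]

theorem span_range_word : Submodule.span K (Set.range (word K)) = ⊤ := by
  rw [← (wordBasis K).span_eq]
  congr 2
  funext l
  exact (wordBasis_apply K l).symm

theorem linearIndependent_word : LinearIndependent K (word K) := by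
  have : word K = wordBasis K := funext fun l => (wordBasis_apply K l).symm
  rw [this]
  exact (wordBasis K).linearIndependent

theorem word_mem_homogeneous {k : ℕ} {l : List (Fin 2)} (h : l.length = k) :
    word K l ∈ homogeneous K k :=
  Submodule.subset_span ⟨l, h, rfl⟩

theorem mul_mem_homogeneous {j k : ℕ} {p q : FreeAlg K} (hp : p ∈ homogeneous K j)
    (hq : q ∈ homogeneous K k) : p * q ∈ homogeneous K (j + k) := by
  have h := Submodule.mul_mem_mul hp hq
  rw [homogeneous, homogeneous, Submodule.span_mul_span] at h
  refine Submodule.span_mono ?_ h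
  rintro _ ⟨_, ⟨u, hu, rfl⟩, _, ⟨v, hv, rfl⟩, rfl⟩
  have hu' : u.length = j := hu
  have hv' : v.length = k := hv
  exact ⟨u ++ v, by simp [hu', hv'], word_append u v⟩

theorem pderiv_mem_homogeneous {k : ℕ} {F : FreeAlg K} (hF : F ∈ homogeneous K (k + 1))
    (i : Fin 2) : pderiv K i F ∈ homogeneous K k := by
  suffices homogeneous K (k + 1) ≤ (homogeneous K k).comap (pderiv K i) from this hF
  refine Submodule.span_le.mpr ?_
  rintro _ ⟨_ | ⟨a, u⟩, hl, rfl⟩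
  · simp at hl
  · simp only [Submodule.comap_coe, Set.mem_preimage, SetLike.mem_coe, pderiv_word_cons]
    split_ifs
    · exact word_mem_homogeneous (by simpa using hl)
    · exact zero_mem _

theorem finrank_homogeneous (k : ℕ) : Module.finrank K (homogeneous K k) = 2 ^ k := by
  have : Fintype {l : List (Fin 2) | l.length = k} :=
    (List.finite_length_eq (Fin 2) k).fintype
  rw [homogeneous, Set.image_eq_range]
  refine (finrank_span_eq_card (linearIndependent_word.comp _ Subtype.val_injective)).trans ?_
  have h : Fintype.card (List.Vector (Fin 2) k) = 2 ^ k := by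
    rw [card_vector, Fintype.card_fin]
  rw [← h]
  exact Fintype.card_congr (Equiv.refl _)

/-- The element `u rᵢ v` of the relation ideal, where `rᵢ` is the `i`-th partial derivative of `F`. -/
def relTerm (F : FreeAlg K) (t : List (Fin 2) × Fin 2 × List (Fin 2)) : FreeAlg K :=
  word K t.1 * pderiv K t.2.1 F * word K t.2.2

theorem mul_mem_span_relTerm {F x : FreeAlg K} (y : FreeAlg K)
    (hx : x ∈ Submodule.span K (Set.range (relTerm F))) :
    y * x ∈ Submodule.span K (Set.range (relTerm F)) ∧
      x * y ∈ Submodule.span K (Set.range (relTerm F)) := by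
  have hy : y ∈ Submodule.span K (Set.range (word K)) := span_range_word (K := K) ▸ trivial
  have h1 := Submodule.mul_mem_mul hy hx
  have h2 := Submodule.mul_mem_mul hx hy
  rw [Submodule.span_mul_span] at h1 h2
  constructor
  · refine Submodule.span_mono ?_ h1
    rintro _ ⟨_, ⟨w, rfl⟩, _, ⟨⟨u, i, v⟩, rfl⟩, rfl⟩
    exact ⟨(w ++ u, i, v), by simp only [relTerm, word_append, mul_assoc]⟩
  · refine Submodule.span_mono ?_ h2
    rintro _ ⟨_, ⟨⟨u, i, v⟩, rfl⟩, _, ⟨w, rfl⟩, rfl⟩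
    exact ⟨(u, i, v ++ w), by simp only [relTerm, word_append, mul_assoc]⟩

theorem mem_relIdeal_iff {F x : FreeAlg K} :
    x ∈ relIdeal F ↔ x ∈ Submodule.span K (Set.range (relTerm F)) := by
  constructor
  · intro hx
    let J : TwoSidedIdeal (FreeAlg K) := TwoSidedIdeal.mk'
      (Submodule.span K (Set.range (relTerm F)) : Set (FreeAlg K))
      (Submodule.zero_mem _) (Submodule.add_mem _) (Submodule.neg_mem _)
      (fun {y _} h => (mul_mem_span_relTerm y h).1) (fun {_ y} h => (mul_mem_span_relTerm y h).2)
    have hJ : relIdeal F ≤ J := by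
      refine TwoSidedIdeal.span_le.mpr ?_
      have h : ∀ i, pderiv K i F ∈ J := fun i =>
        (TwoSidedIdeal.mem_mk' _ _ _ _ _ _ _).mpr
          (Submodule.subset_span ⟨([], i, []), by simp [relTerm, word_nil]⟩)
      rintro _ (rfl | rfl)
      · exact h 0
      · exact h 1
    exact (TwoSidedIdeal.mem_mk' _ _ _ _ _ _ _).mp (hJ hx)
  · intro hx
    have h : ∀ i, pderiv K i F ∈ relIdeal F := by
      intro i
      refine TwoSidedIdeal.subset_span ?_
      fin_cases i <;> simp
    induction hx using Submodule.span_induction with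
    | mem x hx =>
      obtain ⟨t, rfl⟩ := hx
      exact (relIdeal F).mul_mem_right _ _ ((relIdeal F).mul_mem_left _ _ (h _))
    | zero => exact (relIdeal F).zero_mem
    | add x y _ _ hx hy => exact (relIdeal F).add_mem hx hy
    | smul c x _ hx =>
      rw [Algebra.smul_def]
      exact (relIdeal F).mul_mem_left _ _ hx

theorem toPotAlg_eq_zero_iff {F x : FreeAlg K} :
    toPotAlg F x = 0 ↔ x ∈ Submodule.span K (Set.range (relTerm F)) := by
  rw [← mem_relIdeal_iff, TwoSidedIdeal.mem_iff, ← RingCon.eq]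
  rfl

/-- The projection of `K⟨x, y⟩` onto its homogeneous component of degree `k`. -/
def degreeProj (K : Type*) [Field K] (k : ℕ) : FreeAlg K →ₗ[K] FreeAlg K :=
  (wordBasis K).constr K fun l => if l.length = k then word K l else 0

theorem degreeProj_of_mem {k : ℕ} {x : FreeAlg K} (hx : x ∈ homogeneous K k) :
    degreeProj K k x = x := by
  suffices homogeneous K k ≤ LinearMap.eqLocus (degreeProj K k) LinearMap.id from this hx
  refine Submodule.span_le.mpr ?_
  rintro _ ⟨l, hl, rfl⟩
  have hl' : l.length = k := hl
  simp [← wordBasis_apply, degreeProj, hl']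

theorem degreeProj_of_mem_of_ne {j k : ℕ} (hjk : j ≠ k) {x : FreeAlg K}
    (hx : x ∈ homogeneous K j) : degreeProj K k x = 0 := by
  suffices homogeneous K j ≤ LinearMap.ker (degreeProj K k) from this hx
  refine Submodule.span_le.mpr ?_
  rintro _ ⟨l, hl, rfl⟩
  have hl' : l.length = j := hl
  simp [← wordBasis_apply, degreeProj, hl', hjk]

/-- The index set of the spanning elements `u rᵢ v` of degree `k`, for relations of degree `N + 3`. -/
def triples (N k : ℕ) : Set (List (Fin 2) × Fin 2 × List (Fin 2)) :=
  {t | t.1.length + (N + 3) + t.2.2.length = k}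

theorem finite_setOf_triples (N k : ℕ) : (triples N k).Finite :=
  (finite_triples k).subset fun t h => by
    have h' : t.1.length + (N + 3) + t.2.2.length = k := h
    constructor <;> omega

/-- The degree `k` component of the relation ideal of a potential of degree `N + 4`, described by
its spanning set; see `homogeneous_inf_ker_toPotAlg`. -/
def relComponent (N : ℕ) (F : FreeAlg K) (k : ℕ) : Submodule K (FreeAlg K) :=
  Submodule.span K (relTerm F '' triples N k)

theorem relTerm_mem_homogeneous {N : ℕ} {F : FreeAlg K} (hF : F ∈ homogeneous K (N + 3 + 1))
    (t : List (Fin 2) × Fin 2 × List (Fin 2)) :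
    relTerm F t ∈ homogeneous K (t.1.length + (N + 3) + t.2.2.length) :=
  mul_mem_homogeneous (mul_mem_homogeneous (word_mem_homogeneous rfl)
    (pderiv_mem_homogeneous hF _)) (word_mem_homogeneous rfl)

theorem relComponent_le_homogeneous {N : ℕ} {F : FreeAlg K}
    (hF : F ∈ homogeneous K (N + 3 + 1)) (k : ℕ) : relComponent N F k ≤ homogeneous K k := by
  refine Submodule.span_le.mpr ?_
  rintro _ ⟨t, ht, rfl⟩
  exact (show t.1.length + (N + 3) + t.2.2.length = k from ht) ▸ relTerm_mem_homogeneous hF t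

theorem degreeProj_mem_relComponent {N : ℕ} {F : FreeAlg K} (hF : F ∈ homogeneous K (N + 3 + 1))
    (k : ℕ) {x : FreeAlg K} (hx : x ∈ Submodule.span K (Set.range (relTerm F))) :
    degreeProj K k x ∈ relComponent N F k := by
  suffices Submodule.span K (Set.range (relTerm F)) ≤
    (relComponent N F k).comap (degreeProj K k) from this hx
  refine Submodule.span_le.mpr ?_
  rintro _ ⟨t, rfl⟩
  rw [SetLike.mem_coe, Submodule.mem_comap]
  by_cases h : t.1.length + (N + 3) + t.2.2.length = k
  · rw [degreeProj_of_mem (h ▸ relTerm_mem_homogeneous hF t)]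
    exact Submodule.subset_span ⟨t, h, rfl⟩
  · rw [degreeProj_of_mem_of_ne h (relTerm_mem_homogeneous hF t)]
    exact zero_mem _

theorem homogeneous_inf_ker_toPotAlg {N : ℕ} {F : FreeAlg K}
    (hF : F ∈ homogeneous K (N + 3 + 1)) (k : ℕ) :
    homogeneous K k ⊓ LinearMap.ker (toPotAlg F) = relComponent N F k := by
  refine le_antisymm ?_ (le_inf (relComponent_le_homogeneous hF k) ?_)
  · rintro x ⟨hx, hx0⟩
    rw [← degreeProj_of_mem hx]
    exact degreeProj_mem_relComponent hF k (toPotAlg_eq_zero_iff.mp hx0)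
  · intro x hx
    exact toPotAlg_eq_zero_iff.mpr (Submodule.span_mono (Set.image_subset_range _ _) hx)

instance finite_homogeneous (k : ℕ) : Module.Finite K (homogeneous K k) :=
  Module.Finite.span_of_finite K ((List.finite_length_eq (Fin 2) k).image _)

theorem finrank_component_add_finrank_relComponent {N : ℕ} {F : FreeAlg K}
    (hF : F ∈ homogeneous K (N + 3 + 1)) (k : ℕ) :
    Module.finrank K (component F k) + Module.finrank K (relComponent N F k) = 2 ^ k := by
  have h := LinearMap.finrank_range_add_finrank_ker
    ((toPotAlg F).domRestrict (homogeneous K k))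
  rw [finrank_homogeneous] at h
  have h1 : LinearMap.range ((toPotAlg F).domRestrict (homogeneous K k)) = component F k := by
    rw [component, LinearMap.range_domRestrict]
  have h2 : (LinearMap.ker ((toPotAlg F).domRestrict (homogeneous K k))).map
      (homogeneous K k).subtype = relComponent N F k := by
    rw [← homogeneous_inf_ker_toPotAlg hF k, LinearMap.ker_domRestrict]
    exact Submodule.map_comap_subtype _ _
  rw [h1, ← Submodule.finrank_map_subtype_eq, h2] at h
  exact h

theorem not_finite_potAlg {N : ℕ} {F : FreeAlg K} (hF : F ∈ homogeneous K (N + 3 + 1))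
    (h : ∀ k, Module.finrank K (component F k) ≠ 0) : ¬ Module.Finite K (PotAlg F) := by
  intro hfin
  have h1 : ∀ k, ∃ x ∈ homogeneous K k, toPotAlg F x ≠ 0 := by
    intro k
    by_contra! hk
    refine h k ?_
    have : component F k = ⊥ :=
      (Submodule.map_le_iff_le_comap.mpr hk).antisymm bot_le
    rw [this, finrank_bot]
  choose x hx hx0 using h1
  have hli : LinearIndependent K fun k => toPotAlg F (x k) := by
    rw [linearIndependent_iff']
    intro s g hg i hi
    rw [← map_zero (toPotAlg F)] at hg
    simp only [← map_smul, ← map_sum] at hg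
    rw [map_zero, toPotAlg_eq_zero_iff] at hg
    have h2 := degreeProj_mem_relComponent hF i hg
    rw [map_sum, Finset.sum_eq_single i] at h2
    · rw [map_smul, degreeProj_of_mem (hx i), ← homogeneous_inf_ker_toPotAlg hF] at h2
      have h3 : g i • toPotAlg F (x i) = 0 := by
        rw [← map_smul]; exact h2.2
      exact (smul_eq_zero.mp h3).resolve_right (hx0 i)
    · intro j _ hj
      rw [map_smul, degreeProj_of_mem_of_ne hj (hx j), smul_zero]
    · exact fun h => absurd hi h
  have := hli.finite
  exact not_finite ℕ

/-! ### Syzygies of the relations -/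

/-- Indices of the linear relations between the elements `u rᵢ v` that hold for all potentials. -/
inductive SyzygyIndex : Type
  | potential (u v : List (Fin 2)) : SyzygyIndex
  | koszul (u : List (Fin 2)) (i : Fin 2) (m : List (Fin 2)) (j : Fin 2)
      (v : List (Fin 2)) : SyzygyIndex

/-- The degree of a syzygy between relations of degree `N + 3`. -/
def SyzygyIndex.degree (N : ℕ) : SyzygyIndex → ℕ
  | potential u v => u.length + v.length + (N + 4)
  | koszul u _ m _ v => u.length + m.length + v.length + 2 * (N + 3)

/-- The linear map `p ↦ (u p m, j, v)`, on words `p`, into the free vector space on triples. -/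
def insertLeft (K : Type*) [Field K] (u m : List (Fin 2)) (j : Fin 2) (v : List (Fin 2)) :
    FreeAlg K →ₗ[K] (List (Fin 2) × Fin 2 × List (Fin 2) →₀ K) :=
  (wordBasis K).constr K fun w => Finsupp.single (u ++ w ++ m, j, v) 1

/-- The linear map `p ↦ (u, i, m p v)`, on words `p`, into the free vector space on triples. -/
def insertRight (K : Type*) [Field K] (u : List (Fin 2)) (i : Fin 2) (m v : List (Fin 2)) :
    FreeAlg K →ₗ[K] (List (Fin 2) × Fin 2 × List (Fin 2) →₀ K) :=
  (wordBasis K).constr K fun w => Finsupp.single (u, i, m ++ w ++ v) 1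

theorem insertLeft_word (u m : List (Fin 2)) (j : Fin 2) (v w : List (Fin 2)) :
    insertLeft K u m j v (word K w) = Finsupp.single (u ++ w ++ m, j, v) 1 := by
  rw [← wordBasis_apply, insertLeft, Module.Basis.constr_basis]

theorem insertRight_word (u : List (Fin 2)) (i : Fin 2) (m v w : List (Fin 2)) :
    insertRight K u i m v (word K w) = Finsupp.single (u, i, m ++ w ++ v) 1 := by
  rw [← wordBasis_apply, insertRight, Module.Basis.constr_basis]

/-- The formal combination of triples given by a syzygy. It is constant in `F` for the potential
syzygies `∑ᵢ u xᵢ · rᵢ · v - u · rᵢ · xᵢ v`, and linear in `F` for the Koszul syzygies, the difference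
of the expansions of `u rᵢ m rⱼ v` in `rᵢ` and in `rⱼ`. -/
def syzygy (F : FreeAlg K) : SyzygyIndex → (List (Fin 2) × Fin 2 × List (Fin 2) →₀ K)
  | .potential u v => ∑ i, (Finsupp.single (u ++ [i], i, v) 1 - Finsupp.single (u, i, i :: v) 1)
  | .koszul u i m j v =>
      insertLeft K u m j v (pderiv K i F) - insertRight K u i m v (pderiv K j F)

theorem linearCombination_insertLeft (F p : FreeAlg K) (u m : List (Fin 2)) (j : Fin 2)
    (v : List (Fin 2)) : Finsupp.linearCombination K (relTerm F) (insertLeft K u m j v p) =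
      word K u * p * word K m * pderiv K j F * word K v := by
  have hp : p ∈ Submodule.span K (Set.range (word K)) := span_range_word (K := K) ▸ trivial
  induction hp using Submodule.span_induction with
  | mem x hx =>
    obtain ⟨w, rfl⟩ := hx
    simp [insertLeft_word, relTerm, word_append, mul_assoc]
  | zero => simp
  | add x y _ _ hx hy => simp only [map_add, hx, hy, mul_add, add_mul]
  | smul c x _ hx => simp only [map_smul, hx, mul_smul_comm, smul_mul_assoc]

theorem linearCombination_insertRight (F p : FreeAlg K) (u : List (Fin 2)) (i : Fin 2)
    (m v : List (Fin 2)) : Finsupp.linearCombination K (relTerm F) (insertRight K u i m v p) =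
      word K u * pderiv K i F * word K m * p * word K v := by
  have hp : p ∈ Submodule.span K (Set.range (word K)) := span_range_word (K := K) ▸ trivial
  induction hp using Submodule.span_induction with
  | mem x hx =>
    obtain ⟨w, rfl⟩ := hx
    simp [insertRight_word, relTerm, word_append, mul_assoc]
  | zero => simp
  | add x y _ _ hx hy => simp only [map_add, hx, hy, mul_add, add_mul]
  | smul c x _ hx => simp only [map_smul, hx, mul_smul_comm, smul_mul_assoc]

theorem sum_word_mul_pderiv {d : ℕ} {F : FreeAlg K} (hF : F ∈ homogeneous K (d + 1)) :
    ∑ i, word K [i] * pderiv K i F = F := by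
  induction hF using Submodule.span_induction with
  | mem x hx =>
    obtain ⟨_ | ⟨a, w⟩, hl, rfl⟩ := hx
    · simp at hl
    · simp only [pderiv_word_cons, mul_ite, mul_zero, Finset.sum_ite_eq, Finset.mem_univ, if_true]
      rw [← word_cons]
  | zero => simp
  | add x y _ _ hx hy => simp only [map_add, mul_add, Finset.sum_add_distrib, hx, hy]
  | smul c x _ hx => simp only [map_smul, mul_smul_comm, ← Finset.smul_sum, hx]

theorem sum_pderiv_mul_word {d : ℕ} {F : FreeAlg K} (hF : F ∈ homogeneous K (d + 1)) :
    ∑ i, pderiv K i F * word K [i] = rotate K F := by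
  induction hF using Submodule.span_induction with
  | mem x hx =>
    obtain ⟨_ | ⟨a, w⟩, hl, rfl⟩ := hx
    · simp at hl
    · simp only [pderiv_word_cons, ite_mul, zero_mul, Finset.sum_ite_eq, Finset.mem_univ, if_true,
        rotate_word]
      rw [← word_append]
      simp
  | zero => simp
  | add x y _ _ hx hy => simp only [map_add, add_mul, Finset.sum_add_distrib, hx, hy]
  | smul c x _ hx => simp only [map_smul, smul_mul_assoc, ← Finset.smul_sum, hx]

theorem linearCombination_potential {d : ℕ} {F : FreeAlg K} (hF : IsHomogeneousPotential (d + 1) F)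
    (G : FreeAlg K) (u v : List (Fin 2)) :
    Finsupp.linearCombination K (relTerm F) (syzygy G (.potential u v)) = 0 := by
  have h1 : ∑ i, word K [i] * pderiv K i F = ∑ i, pderiv K i F * word K [i] := by
    rw [sum_word_mul_pderiv hF.homogeneous, sum_pderiv_mul_word hF.homogeneous, hF.cyclic]
  have h2 : Finsupp.linearCombination K (relTerm F) (syzygy G (.potential u v)) =
      word K u * (∑ i, word K [i] * pderiv K i F - ∑ i, pderiv K i F * word K [i]) *
        word K v := by
    simp only [syzygy, map_sum, map_sub, Finsupp.linearCombination_single, one_smul, relTerm,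
      word_append, ← Finset.sum_sub_distrib, Finset.mul_sum, Finset.sum_mul, mul_sub, sub_mul]
    refine Finset.sum_congr rfl fun i _ => ?_
    rw [word_cons i v]
    simp only [mul_assoc]
  rw [h2, h1, sub_self, mul_zero, zero_mul]

theorem linearCombination_syzygy_self {d : ℕ} {F : FreeAlg K}
    (hF : IsHomogeneousPotential (d + 1) F) (z : SyzygyIndex) :
    Finsupp.linearCombination K (relTerm F) (syzygy F z) = 0 := by
  cases z with
  | potential u v => exact linearCombination_potential hF F u v
  | koszul u i m j v =>
    rw [syzygy, map_sub, linearCombination_insertLeft, linearCombination_insertRight, sub_self]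

/-- The polarization of `linearCombination_syzygy_self`. It makes the syzygies of `F + s (G - F)`
relations along the whole line through `F` and `G`. -/
theorem linearCombination_syzygy_add_swap {d : ℕ} {F G : FreeAlg K}
    (hF : IsHomogeneousPotential (d + 1) F) (hG : IsHomogeneousPotential (d + 1) G)
    (z : SyzygyIndex) :
    Finsupp.linearCombination K (relTerm F) (syzygy G z) +
      Finsupp.linearCombination K (relTerm G) (syzygy F z) = 0 := by
  cases z with
  | potential u v => rw [linearCombination_potential hF, linearCombination_potential hG, add_zero]
  | koszul u i m j v =>
    simp only [syzygy, map_sub, linearCombination_insertLeft, linearCombination_insertRight]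
    abel

theorem single_mem_supported {N k : ℕ} {t : List (Fin 2) × Fin 2 × List (Fin 2)}
    (h : t.1.length + (N + 3) + t.2.2.length = k) :
    Finsupp.single t (1 : K) ∈ Finsupp.supported K K (triples N k) :=
  Finsupp.single_mem_supported K _ h

theorem syzygy_mem_supported {N k : ℕ} {F : FreeAlg K} (hF : F ∈ homogeneous K (N + 3 + 1))
    {z : SyzygyIndex} (hz : z.degree N = k) :
    syzygy F z ∈ Finsupp.supported K K (triples N k) := by
  cases z with
  | potential u v =>
    simp only [SyzygyIndex.degree] at hz
    refine Submodule.sum_mem _ fun i _ => Submodule.sub_mem _ ?_ ?_ <;>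
      refine single_mem_supported ?_ <;> simp <;> omega
  | koszul u i m j v =>
    simp only [SyzygyIndex.degree] at hz
    have h1 : homogeneous K (N + 3) ≤
        (Finsupp.supported K K (triples N k)).comap (insertLeft K u m j v) := by
      refine Submodule.span_le.mpr ?_
      rintro _ ⟨w, hw, rfl⟩
      have hw' : w.length = N + 3 := hw
      rw [SetLike.mem_coe, Submodule.mem_comap, insertLeft_word]
      refine single_mem_supported ?_
      simp [hw']; omega
    have h2 : homogeneous K (N + 3) ≤
        (Finsupp.supported K K (triples N k)).comap (insertRight K u i m v) := by
      refine Submodule.span_le.mpr ?_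
      rintro _ ⟨w, hw, rfl⟩
      have hw' : w.length = N + 3 := hw
      rw [SetLike.mem_coe, Submodule.mem_comap, insertRight_word]
      refine single_mem_supported ?_
      simp [hw']; omega
    exact Submodule.sub_mem _ (h1 (pderiv_mem_homogeneous hF i))
      (h2 (pderiv_mem_homogeneous hF j))

/-- The span of the syzygies of degree `k`. -/
def syzygyComponent (N : ℕ) (F : FreeAlg K) (k : ℕ) :
    Submodule K (List (Fin 2) × Fin 2 × List (Fin 2) →₀ K) :=
  Submodule.span K (Set.range fun z : {z : SyzygyIndex // z.degree N = k} => syzygy F z)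

/-- The syzygies of one potential `G` bound the dimension of the relation ideal of any other
potential `F` of the same degree. -/
theorem finrank_relComponent_add_finrank_syzygyComponent_le {N : ℕ} {F G : FreeAlg K}
    (hF : IsHomogeneousPotential (N + 3 + 1) F) (hG : IsHomogeneousPotential (N + 3 + 1) G)
    (k : ℕ) : Module.finrank K (relComponent N F k) +
      Module.finrank K (syzygyComponent N G k) ≤ (triples N k).ncard := by
  have hfin := finite_setOf_triples N k
  rw [Set.ncard_eq_toFinset_card _ hfin]
  have h := finrank_span_add_finrank_span_le hfin.toFinset (relTerm G) (relTerm F)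
    (fun z : {z : SyzygyIndex // z.degree N = k} => syzygy G z) (fun z => syzygy F z)
    (fun z => by rw [hfin.coe_toFinset]; exact syzygy_mem_supported hG.homogeneous z.2)
    (fun z => by rw [hfin.coe_toFinset]; exact syzygy_mem_supported hF.homogeneous z.2)
    (fun z => linearCombination_syzygy_self hG z) (fun z => linearCombination_syzygy_self hF z)
    (fun z => linearCombination_syzygy_add_swap hG hF z)
  rw [hfin.coe_toFinset] at h
  exact h

/-! ### Reduction to normal words -/

/-- The span of the words of length `N + 3` that are lighter than the `i`-th leading word. -/
def lowerSpan (K : Type*) [Field K] (N : ℕ) (i : Fin 2) : Submodule K (FreeAlg K) :=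
  Submodule.span K (word K '' {p | p.length = N + 3 ∧ wordWeight p < wordWeight (leadingWord N i)})

/-- The partial derivatives of `G` are monic with leading words `leadingWord N 0`, `leadingWord N 1`. -/
def HasLeadingWords (N : ℕ) (G : FreeAlg K) : Prop :=
  ∀ i, pderiv K i G - word K (leadingWord N i) ∈ lowerSpan K N i

theorem wordWeight_sandwich_lt {u v p q : List (Fin 2)} (hl : p.length = q.length)
    (h : wordWeight p < wordWeight q) : wordWeight (u ++ p ++ v) < wordWeight (u ++ q ++ v) := by
  simp only [wordWeight_append, List.length_append, hl]
  have : 2 ^ u.length * wordWeight p < 2 ^ u.length * wordWeight q :=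
    Nat.mul_lt_mul_of_pos_left h (by positivity)
  omega

/-- Modulo the syzygies of `G`, every triple is a combination of reduced ones. The proof is by
induction on the weight of the word `u ++ leadingWord N i ++ v` and then on the length of `v`. If `v`
contains a leading word, a Koszul syzygy moves the marked factor there; if `i = 0` and `v` begins
with `x`, the potential syzygy does, since `yyxⁿ⁻²x = y(yxⁿ⁻¹)`. -/
theorem single_mem_syzygyComponent_sup {N : ℕ} {G : FreeAlg K} (hG : HasLeadingWords N G)
    (k : ℕ) : ∀ t ∈ triples N k, Finsupp.single t (1 : K) ∈ syzygyComponent N G k ⊔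
      Submodule.span K ((fun t => Finsupp.single t (1 : K)) '' reducedTriples N k) := by
  set R := syzygyComponent N G k ⊔
      Submodule.span K ((fun t => Finsupp.single t (1 : K)) '' reducedTriples N k)
  have hsyz : ∀ z : SyzygyIndex, z.degree N = k → syzygy G z ∈ R := fun z hz =>
    Submodule.mem_sup_left (Submodule.subset_span ⟨⟨z, hz⟩, rfl⟩)
  suffices ∀ M L : ℕ, ∀ u i v, (u, i, v) ∈ triples N k →
      wordWeight (u ++ leadingWord N i ++ v) = M → v.length = L →
      Finsupp.single (u, i, v) (1 : K) ∈ R from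
    fun ⟨u, i, v⟩ ht => this _ _ u i v ht rfl rfl
  intro M
  induction M using Nat.strong_induction_on with
  | _ M ihM =>
  intro L
  induction L using Nat.strong_induction_on with
  | _ L ihL =>
  intro u i v ht hM hL
  have ht' : u.length + (N + 3) + v.length = k := ht
  by_cases hv : Normal N v
  · by_cases hr : i = 0 → ∀ w, v ≠ 0 :: w
    · exact Submodule.mem_sup_right (Submodule.subset_span ⟨_, ⟨ht, hv, hr⟩, rfl⟩)
    · push Not at hr
      obtain ⟨rfl, w, rfl⟩ := hr
      simp only [List.length_cons] at ht' hL
      -- the three other terms of the potential syzygy: `u x · r₀ · w` and `u · r₁ · y w` have lighter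
      -- words, and `u y · r₁ · w` has the same word with a shorter right factor
      have h0 : Finsupp.single (u ++ [0], 0, w) (1 : K) ∈ R := by
        refine ihM _ ?_ _ _ _ _ ?_ rfl rfl
        · rw [← hM]
          have e1 : u ++ [0] ++ leadingWord N 0 ++ w = u ++ (0 :: leadingWord N 0) ++ w := by simp
          have e2 : u ++ leadingWord N 0 ++ 0 :: w = u ++ (leadingWord N 0 ++ [0]) ++ w := by simp
          rw [e1, e2]
          refine wordWeight_sandwich_lt (by simp) ?_
          have a1 := wordWeight_replicate_zero (N + 1)
          have a2 := wordWeight_replicate_zero (N + 1 + 1)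
          simp only [leadingWord, if_true, List.cons_append, ← List.replicate_succ']
          simp only [pow_succ] at a1 a2
          simp [wordWeight]
          omega
        · show _ = _
          simp; omega
      have h1 : Finsupp.single (u ++ [1], 1, w) (1 : K) ∈ R := by
        have e1 : u ++ [1] ++ leadingWord N 1 ++ w = u ++ leadingWord N 0 ++ 0 :: w := by
          simp [leadingWord, List.replicate_succ' (n := N + 1)]
        refine ihL _ ?_ _ _ _ ?_ (by rw [e1, hM]) rfl
        · omega
        · show _ = _
          simp; omega
      have h2 : Finsupp.single (u, 1, 1 :: w) (1 : K) ∈ R := by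
        refine ihM _ ?_ _ _ _ _ ?_ rfl rfl
        · rw [← hM]
          have e1 : u ++ leadingWord N 1 ++ 1 :: w = u ++ (leadingWord N 1 ++ [1]) ++ w := by simp
          have e2 : u ++ leadingWord N 0 ++ 0 :: w = u ++ (leadingWord N 0 ++ [0]) ++ w := by simp
          rw [e1, e2]
          refine wordWeight_sandwich_lt (by simp [length_leadingWord]) ?_
          have a1 := wordWeight_replicate_zero (N + 2)
          simp only [leadingWord, if_true, List.cons_append, ← List.replicate_succ',
            show N + 1 + 1 = N + 2 from rfl]
          simp only [pow_succ] at a1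
          simp [wordWeight, wordWeight_append]
          omega
        · show _ = _
          simp; omega
      have h3 := hsyz (.potential u w) (by simp only [SyzygyIndex.degree]; omega)
      simp only [syzygy, Fin.sum_univ_two] at h3
      have h4 := R.sub_mem (R.sub_mem (R.add_mem h0 h1) h2) h3
      convert h4 using 1
      abel
  · obtain ⟨m, j, w, rfl⟩ := exists_leadingWord_of_not_normal hv
    simp only [List.length_append, length_leadingWord] at ht' hL
    have hright : pderiv K j G - word K (leadingWord N j) ∈
        R.comap (insertRight K u i m w) := by
      refine (Submodule.span_le.mpr ?_ : lowerSpan K N j ≤ _) (hG j)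
      rintro _ ⟨p, ⟨hpl, hp⟩, rfl⟩
      rw [SetLike.mem_coe, Submodule.mem_comap, insertRight_word]
      refine ihM _ ?_ _ _ _ _ ?_ rfl rfl
      · rw [← hM]
        have h1 := wordWeight_sandwich_lt (u := u ++ leadingWord N i ++ m) (v := w)
          (hpl.trans (length_leadingWord N j).symm) hp
        simpa only [List.append_assoc] using h1
      · show _ = _
        simp [hpl]; omega
    have hleft : pderiv K i G - word K (leadingWord N i) ∈
        R.comap (insertLeft K u m j w) := by
      refine (Submodule.span_le.mpr ?_ : lowerSpan K N i ≤ _) (hG i)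
      rintro _ ⟨p, ⟨hpl, hp⟩, rfl⟩
      rw [SetLike.mem_coe, Submodule.mem_comap, insertLeft_word]
      refine ihM _ ?_ _ _ _ _ ?_ rfl rfl
      · rw [← hM]
        have h1 := wordWeight_sandwich_lt (u := u) (v := m ++ leadingWord N j ++ w)
          (hpl.trans (length_leadingWord N i).symm) hp
        simpa only [List.append_assoc] using h1
      · show _ = _
        simp [hpl]; omega
    have hlead : Finsupp.single (u ++ leadingWord N i ++ m, j, w) (1 : K) ∈ R := by
      refine ihL _ ?_ _ _ _ ?_ ?_ rfl
      · omega
      · show _ = _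
        simp [length_leadingWord]; omega
      · rw [← hM]; simp only [List.append_assoc]
    have h3 := hsyz (.koszul u i m j w) (by simp only [SyzygyIndex.degree]; omega)
    rw [Submodule.mem_comap, map_sub, insertRight_word] at hright
    rw [Submodule.mem_comap, map_sub, insertLeft_word] at hleft
    simp only [syzygy] at h3
    have h4 := R.sub_mem (R.sub_mem (R.add_mem hleft hlead) hright) h3
    convert h4 using 1
    abel

theorem finrank_span_image_le {V ι : Type*} [AddCommGroup V] [Module K V] (f : ι → V) {s : Set ι}
    (hs : s.Finite) : Module.finrank K (Submodule.span K (f '' s)) ≤ s.ncard := by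
  have := (hs.image f).fintype
  refine (finrank_span_le_card (R := K) (f '' s)).trans ?_
  rw [← Set.ncard_eq_toFinset_card']
  exact Set.ncard_image_le hs

theorem ncard_triples_le {N : ℕ} {G : FreeAlg K} (hG : G ∈ homogeneous K (N + 3 + 1))
    (hL : HasLeadingWords N G) (k : ℕ) :
    (triples N k).ncard ≤
      Module.finrank K (syzygyComponent N G k) + (reducedTriples N k).ncard := by
  have hfin := finite_setOf_triples N k
  have : Module.Finite K (Finsupp.supported K K (triples N k)) := by
    rw [Finsupp.supported_eq_span_single]
    exact Module.Finite.span_of_finite K (hfin.image _)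
  have hs : syzygyComponent N G k ≤ Finsupp.supported K K (triples N k) := by
    refine Submodule.span_le.mpr ?_
    rintro _ ⟨z, rfl⟩
    exact syzygy_mem_supported hG z.2
  have : Module.Finite K (syzygyComponent N G k) := Submodule.finiteDimensional_of_le hs
  have : Module.Finite K
      (Submodule.span K ((fun t => Finsupp.single t (1 : K)) '' reducedTriples N k)) :=
    Module.Finite.span_of_finite K ((finite_reducedTriples N k).image _)
  have h1 : Module.finrank K (Finsupp.supported K K (triples N k)) = (triples N k).ncard := by
    have := hfin.fintype
    rw [(Finsupp.supportedEquivFinsupp (M := K) (R := K) (triples N k)).finrank_eq,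
      Module.finrank_finsupp_self, Set.ncard_eq_toFinset_card', Set.toFinset_card]
  have h2 : Finsupp.supported K K (triples N k) ≤ syzygyComponent N G k ⊔
      Submodule.span K ((fun t => Finsupp.single t (1 : K)) '' reducedTriples N k) := by
    rw [Finsupp.supported_eq_span_single]
    refine Submodule.span_le.mpr ?_
    rintro _ ⟨t, ht, rfl⟩
    exact single_mem_syzygyComponent_sup hL k t ht
  rw [← h1]
  refine (Submodule.finrank_mono h2).trans ((Submodule.finrank_add_le_finrank_add_finrank _ _).trans
    (Nat.add_le_add_left (finrank_span_image_le _ (finite_reducedTriples N k)) _))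

theorem ncard_normalWords_le_finrank_component {N : ℕ} {F G : FreeAlg K}
    (hF : IsHomogeneousPotential (N + 3 + 1) F) (hG : IsHomogeneousPotential (N + 3 + 1) G)
    (hL : HasLeadingWords N G) (k : ℕ) :
    (normalWords N k).ncard ≤ Module.finrank K (component F k) := by
  have h1 := finrank_relComponent_add_finrank_syzygyComponent_le hF hG k
  have h2 := ncard_triples_le hG.homogeneous hL k
  have h3 := ncard_normalWords_add_ncard_reducedTriples N k
  have h4 := finrank_component_add_finrank_relComponent hF.homogeneous k
  omega

/-- Normal words span `A_G`: replace a leading word by the lighter words of its relation. -/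
theorem word_mem_relComponent_sup {N : ℕ} {G : FreeAlg K} (hG : HasLeadingWords N G)
    (k : ℕ) : ∀ w : List (Fin 2), w.length = k → word K w ∈ relComponent N G k ⊔
      Submodule.span K (word K '' normalWords N k) := by
  set R := relComponent N G k ⊔ Submodule.span K (word K '' normalWords N k)
  suffices ∀ M : ℕ, ∀ w : List (Fin 2), w.length = k → wordWeight w = M → word K w ∈ R from
    fun w hw => this _ w hw rfl
  intro M
  induction M using Nat.strong_induction_on with
  | _ M ih =>
  intro w hw hM
  by_cases hn : Normal N w
  · exact Submodule.mem_sup_right (Submodule.subset_span ⟨w, ⟨hw, hn⟩, rfl⟩)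
  · obtain ⟨u, i, v, rfl⟩ := exists_leadingWord_of_not_normal hn
    simp only [List.length_append, length_leadingWord] at hw
    let f : FreeAlg K →ₗ[K] FreeAlg K :=
      LinearMap.mulRight K (word K v) ∘ₗ LinearMap.mulLeft K (word K u)
    have hf : ∀ p, f p = word K u * p * word K v := fun p => rfl
    have hlow : pderiv K i G - word K (leadingWord N i) ∈ R.comap f := by
      refine (Submodule.span_le.mpr ?_ : lowerSpan K N i ≤ _) (hG i)
      rintro _ ⟨p, ⟨hpl, hp⟩, rfl⟩
      rw [SetLike.mem_coe, Submodule.mem_comap, hf, ← word_append, ← word_append]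
      refine ih _ ?_ _ ?_ rfl
      · rw [← hM]
        exact wordWeight_sandwich_lt (hpl.trans (length_leadingWord N i).symm) hp
      · simp [hpl]; omega
    have hrel : relTerm G (u, i, v) ∈ R :=
      Submodule.mem_sup_left (Submodule.subset_span ⟨_, hw, rfl⟩)
    rw [Submodule.mem_comap, map_sub, hf, hf, ← word_append, ← word_append] at hlow
    have h := R.sub_mem hrel hlow
    rwa [relTerm, sub_sub_cancel] at h

theorem finrank_component_le_ncard_normalWords {N : ℕ} {G : FreeAlg K}
    (hG : G ∈ homogeneous K (N + 3 + 1)) (hL : HasLeadingWords N G) (k : ℕ) :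
    Module.finrank K (component G k) ≤ (normalWords N k).ncard := by
  have h1 := finrank_component_add_finrank_relComponent hG k
  have h2 : homogeneous K k ≤ relComponent N G k ⊔
      Submodule.span K (word K '' normalWords N k) := by
    refine Submodule.span_le.mpr ?_
    rintro _ ⟨w, hw, rfl⟩
    exact word_mem_relComponent_sup hL k w hw
  have : Module.Finite K (relComponent N G k) :=
    Submodule.finiteDimensional_of_le (relComponent_le_homogeneous hG k)
  have : Module.Finite K (Submodule.span K (word K '' normalWords N k)) :=
    Module.Finite.span_of_finite K ((finite_normalWords N k).image _)
  have h3 := (Submodule.finrank_mono h2).trans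
    ((Submodule.finrank_add_le_finrank_add_finrank _ _).trans
      (Nat.add_le_add_left (finrank_span_image_le _ (finite_normalWords N k)) _))
  rw [finrank_homogeneous] at h3
  omega

/-! ### The potential given by the cyclic sum of the minimal word -/

theorem isHomogeneousPotential_cyclicSum (K : Type*) [Field K] (w : List (Fin 2)) :
    IsHomogeneousPotential w.length (cyclicSum K w) := by
  constructor
  · refine Submodule.sum_mem _ fun v hv => word_mem_homogeneous ?_
    rw [List.mem_toFinset, List.mem_cyclicPermutations_iff] at hv
    exact hv.perm.length_eq
  · have hrot : ∀ v ∈ w.cyclicPermutations.toFinset,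
        v.rotate 1 ∈ w.cyclicPermutations.toFinset := by
      intro v hv
      rw [List.mem_toFinset, List.mem_cyclicPermutations_iff] at hv ⊢
      exact (List.IsRotated.symm ⟨1, rfl⟩).trans hv
    have hinj : Set.InjOn (fun v : List (Fin 2) => v.rotate 1)
        (w.cyclicPermutations.toFinset : Set (List (Fin 2))) :=
      (List.rotate_injective 1).injOn
    rw [cyclicSum, map_sum]
    simp only [rotate_word]
    exact Finset.sum_nbij (fun v => v.rotate 1) hrot hinj
      (Finset.surjOn_of_injOn_of_card_le _ hrot hinj le_rfl) fun _ _ => rfl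

theorem wordWeight_leadingWord (N : ℕ) (i : Fin 2) :
    wordWeight (leadingWord N i) + 2 ^ (leadingWord N i).count 1 = 2 ^ (N + 3) := by
  have h1 := wordWeight_replicate_zero (N + 1)
  have h2 := wordWeight_replicate_zero (N + 2)
  fin_cases i <;> simp [leadingWord, List.count_replicate, wordWeight] <;>
    simp only [pow_succ] at * <;> omega

theorem cons_leadingWord_isRotated (N : ℕ) (i : Fin 2) :
    (i :: leadingWord N i) ~r minimalWord (N + 3) := by
  obtain rfl | rfl : i = 0 ∨ i = 1 := by omega
  · have e1 : (0 : Fin 2) :: leadingWord N 0 = [0, 1, 1] ++ List.replicate (N + 1) 0 := by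
      simp [leadingWord]
    have e2 : minimalWord (N + 3) = List.replicate (N + 1) 0 ++ [0, 1, 1] := by
      simp [minimalWord, List.replicate_succ' (n := N + 1)]
    rw [e1, e2]
    exact List.isRotated_append
  · have e1 : (1 : Fin 2) :: leadingWord N 1 = [1, 1] ++ List.replicate (N + 2) 0 := by
      simp [leadingWord]
    rw [e1]
    exact List.isRotated_append

/-- All words in the `i`-th partial derivative of `xⁿ⁻¹y²↻` are rearrangements of the `i`-th leading
word, and that is the heaviest of its rearrangements. -/
theorem hasLeadingWords_cyclicSum (K : Type*) [Field K] (N : ℕ) :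
    HasLeadingWords N (cyclicSum K (minimalWord (N + 3))) := by
  intro i
  have hmem : i :: leadingWord N i ∈ (minimalWord (N + 3)).cyclicPermutations.toFinset := by
    rw [List.mem_toFinset, List.mem_cyclicPermutations_iff]
    exact cons_leadingWord_isRotated N i
  rw [cyclicSum, map_sum, ← Finset.add_sum_erase _ _ hmem, pderiv_word_cons, if_pos rfl,
    add_sub_cancel_left]
  refine Submodule.sum_mem _ fun v hv => ?_
  rw [Finset.mem_erase, List.mem_toFinset, List.mem_cyclicPermutations_iff] at hv
  obtain ⟨hne, hv⟩ := hv
  obtain _ | ⟨a, p⟩ := v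
  · rw [pderiv_word_nil]; exact zero_mem _
  · rw [pderiv_word_cons]
    split_ifs with ha
    · subst ha
      have hperm := (hv.trans (cons_leadingWord_isRotated N a).symm).perm.cons_inv
      have hl : p.length = N + 3 := hperm.length_eq.trans (length_leadingWord N a)
      refine Submodule.subset_span ⟨p, ⟨hl, ?_⟩, rfl⟩
      have h1 := wordWeight_add_two_pow_count_le p
      have h2 := wordWeight_leadingWord N a
      rw [hperm.count_eq, hl] at h1
      refine lt_of_le_of_ne (by omega) fun h => hne ?_
      rw [wordWeight_injective hperm.length_eq h]
    · exact zero_mem _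

end PotentialAlgebra

end

theorem theorem3p2 (K : Type*) [Field K] :
    (∀ (d : ℕ) (F : PotentialAlgebra.FreeAlg K), 4 ≤ d →
      PotentialAlgebra.IsHomogeneousPotential d F →
      ¬ Module.Finite K (PotentialAlgebra.PotAlg F)) ∧
    ∀ n : ℕ, 3 ≤ n →
      (∀ F : PotentialAlgebra.FreeAlg K,
        PotentialAlgebra.IsHomogeneousPotential (n + 1) F →
        ∀ k : ℕ, PowerSeries.coeff k (PotentialAlgebra.minimalSeries n) ≤
          PowerSeries.coeff k (PotentialAlgebra.hilbertSeries F)) ∧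
      PotentialAlgebra.IsHomogeneousPotential (n + 1)
        (PotentialAlgebra.cyclicSum K (PotentialAlgebra.minimalWord n)) ∧
      PotentialAlgebra.hilbertSeries
          (PotentialAlgebra.cyclicSum K (PotentialAlgebra.minimalWord n)) =
        PotentialAlgebra.minimalSeries n := by
  open PotentialAlgebra in
  have hpot : ∀ N : ℕ,
      IsHomogeneousPotential (N + 3 + 1) (cyclicSum K (minimalWord (N + 3))) := by
    intro N
    have h := isHomogeneousPotential_cyclicSum K (minimalWord (N + 3))
    have hl : (minimalWord (N + 3)).length = N + 3 + 1 := by simp [minimalWord]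
    rwa [hl] at h
  have hlow : ∀ N (F : FreeAlg K), IsHomogeneousPotential (N + 3 + 1) F → ∀ k,
      (normalWords N k).ncard ≤ Module.finrank K (component F k) := fun N F hF k =>
    ncard_normalWords_le_finrank_component hF (hpot N) (hasLeadingWords_cyclicSum K N) k
  refine ⟨fun d F hd hF => ?_, fun n hn => ?_⟩
  · obtain ⟨N, rfl⟩ : ∃ N, d = N + 3 + 1 := ⟨d - 4, by omega⟩
    refine not_finite_potAlg hF.homogeneous fun k h0 => ?_
    have h1 := hlow N F hF k
    rw [h0, Nat.le_zero, Set.ncard_eq_zero (finite_normalWords N k)] at h1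
    have h2 : List.replicate k 1 ∈ normalWords N k :=
      ⟨List.length_replicate, normal_replicate_one N k⟩
    rw [h1] at h2
    exact h2
  · obtain ⟨N, rfl⟩ : ∃ N, n = N + 3 := ⟨n - 3, by omega⟩
    refine ⟨fun F hF k => ?_, hpot N, ?_⟩
    · rw [coeff_minimalSeries, hilbertSeries, PowerSeries.coeff_mk]
      exact_mod_cast hlow N F hF k
    · ext k
      rw [coeff_minimalSeries, hilbertSeries, PowerSeries.coeff_mk]
      exact_mod_cast le_antisymm (finrank_component_le_ncard_normalWords (hpot N).homogeneous
        (hasLeadingWords_cyclicSum K N) k) (hlow N _ (hpot N) k)
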